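/- **Partial operations.** For a partial binary operation on a set we say "$st$ is defined" if $(s,t)$ lies in its domain. **Left restriction categories.** A left restriction category is a small category with set of arrows $\mathcal C$, whose objects are identified with their identity arrows, with maps $D,R$ (domain and range; $fg$ is defined iff $D(f)=R(g)$), together with a map $f\mapsto f^+$ sending each arrow $f\colon A\to B$ to an arrow $f^+\colon B\to B$ such that $f^+f=f$; $f^+g^+=g^+f^+$ and $f^+g^+=(f^+g)^+$ whenever $R(f)=R(g)$; and $fg^+=(fg)^+f$ whenever $D(f)=R(g)$. Put $s\le t$ iff $s^+t$ is defined and $s^+t=s$. A *restriction morphism* is a map $\varphi$ between the sets of arrows such that (rm1) if $st$ is defined then $\varphi(s)\varphi(t)$ is defined and equals $\varphi(st)$; (rm2) $\varphi(s^+)=\varphi(s)^+$. A *premorphism* is a map $\varphi$ between the sets of arrows such that (pm1) if $st$ is defined then $\varphi(s)\varphi(t)$ and $\varphi(s)^+\varphi(st)$ are defined and equal; (pm2) $\varphi(s)^+\le\varphi(s^+)$. (Preservation of identity arrows is not required.) **Li-constellations.** A left constellation is a set $T$ with a partial binary operation and a map $x\mapsto x^+$ such that, with $T^+=\{x^+ :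 x\in T\}$: (c1) $xy$ and $yz$ are defined iff $yz$ and $x(yz)$ are defined; (c2) if $xy,yz$ are defined, then $(xy)z$ is defined and $x(yz)=(xy)z$; (c3) for $e\in T^+$: $ex$ is defined and $ex=x$ iff $e=x^+$; (c4) if $e\in T^+$ and $xe$ is defined, then $xe=x$. Connected components of $(T^+,\le)$ are the classes of the equivalence relation generated by $\le$ on $T^+$. A *locally inductive left constellation* (li-constellation) is a left constellation with a partial order $\le$ such that, for all $x,y,x',y'\in T$ and $e,f\in T^+$: 1. if $x\le y$, $x'\le y'$ and $xx',yy'$ are defined, then $xx'\le yy'$; 2. if $x\le y$, then $x^+\le y^+$; 3. if $e\le x^+$, there is a unique element $e|x$ (the restriction) with $e|x\le x$ and $(e|x)^+=e$; 4. the set $\{y : y\le x,\ ye \text{ is defined}\}$ is empty or has a maximum element, in which case this maximum is denoted $x|e$ (the corestriction) and we write $x|e\neq\emptyset$; 5. if $xy$ is defined, then $(xy)|e\ne\emptyset$ iff $y|e\neq\emptyset$; 6. if $f\le e$, then $x|e\neq\emptyset$ iff $x|f\ne\emptyset$; 7. if $xy$ is defined and $(xy)|e\neq\emptyset$, then $((xy)|e)^+=(x|(y|e)^+)^+$;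 8. if $e\le f$, the restriction $e|f$ and the corestriction $e|f$ coincide; 9. $e|f\neq\emptyset$ (as a corestriction) iff $e,f$ lie in the same connected component of $T^+$, and then $e|f$ is the meet of $e$ and $f$ in $T^+$. It is *non-degenerate* if for every $x\in T$ there is $e\in T^+$ with $x|e\neq\emptyset$. It is *unitary* if every connected component of $T^+$ has a maximum element and, whenever $1$ is such a maximum and $x|1\neq\emptyset$, one has $x|1=x$. Put $x\otimes y=(x|y^+)y$, defined when $x|y^+\neq\emptyset$. An *inductive radiant* is a map $\varphi$ between li-constellations such that, for all $x,y$ and $e\in T^+$: (ir1) if $xy$ is defined then $\varphi(x)\varphi(y)$ is defined and equals $\varphi(xy)$; (ir2) $\varphi(x)^+=\varphi(x^+)$; (ir3) $x\le y$ implies $\varphi(x)\le\varphi(y)$; (ir4) if $x|e\neq\emptyset$ then $\varphi(x)|\varphi(e)\neq\emptyset$ and $\varphi(x|e)=\varphi(x)|\varphi(e)$. An *inductive preradiant* is a map $\varphi$ satisfying (ir3), (ir4) and: (ip1) if $xy$ is defined, then $\varphi(x)\otimes\varphi(y)$ and $\varphi(x)^+\otimes\varphi(xy)$ are defined and equal;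 (ip2) $\varphi(x)^+\le\varphi(x^+)$; (ip5) if $e\le x^+$, then $\varphi(e|x)^+$ is the corestriction $\varphi(e)|\varphi(x)^+$. **Theorem (ESN-type theorem for left restriction categories).** In each case below composition is composition of functions, and *isomorphic* means that there are mutually inverse functors. (i) The category of left restriction categories and restriction morphisms is isomorphic to the category of non-degenerate unitary li-constellations and inductive radiants. (ii) The category of left restriction categories and premorphisms is isomorphic to the category of non-degenerate unitary li-constellations and inductive preradiants. -/

import Mathlib

open CategoryTheory

universe u

namespace ESN

/-!
Partial binary operations on `α` are functions `mul : α → α → Option α`: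
`mul s t = some r` says that `st` is defined and equals `r`, and `mul s t = none` says that
`st` is undefined.  Thus `mul` is a subset of `α × α` together with a map from it to `α`.
-/

/-- A semigroupoid on the set `α`: if `st`, `tr` are defined, or `st`, `(st)r` are defined, or
`tr`, `s(tr)` are defined, then all four products are defined and `(st)r = s(tr)`. -/
@[ext] structure Semigroupoid (α : Type u) where
  mul : α → α → Option α
  s1 : ∀ s t r a b, mul s t = some a → mul t r = some b →
    ∃ c, mul a r = some c ∧ mul s b = some c
  s2 : ∀ s t r a c, mul s t = some a → mul a r = some c →
    ∃ b, mul t r = some b ∧ mul s b = some c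
  s3 : ∀ s t r b c, mul t r = some b → mul s b = some c →
    ∃ a, mul s t = some a ∧ mul a r = some c

/-- A left restriction semigroupoid on the set `α`. -/
@[ext] structure LRSemigroupoid (α : Type u) extends Semigroupoid α where
  plus : α → α
  /-- `s⁺s` is defined and equals `s` -/
  lr1 : ∀ s, mul (plus s) s = some s
  /-- `s⁺t⁺` is defined iff `t⁺s⁺` is, and then they are equal -/
  lr2 : ∀ s t, mul (plus s) (plus t) = mul (plus t) (plus s)
  /-- if `s⁺t` is defined, then `(s⁺t)⁺ = s⁺t⁺` -/
  lr3 : ∀ s t r, mul (plus s) t = some r → mul (plus s) (plus t) = some (plus r)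
  /-- if `st` is defined, then `st⁺ = (st)⁺s` -/
  lr4 : ∀ s t r, mul s t = some r → ∃ q, mul s (plus t) = some q ∧ mul (plus r) s = some q

namespace LRSemigroupoid

variable {α β γ : Type u}

/-- The natural partial order: `s ≤ t` iff `s⁺t` is defined and equals `s`. -/
def NatLE (S : LRSemigroupoid α) (s t : α) : Prop := S.mul (S.plus s) t = some s

/-- Restriction morphisms between left restriction semigroupoids. -/
structure IsRestrictionMorphism (S : LRSemigroupoid α) (T : LRSemigroupoid β)
    (φ : α → β) : Prop where
  /-- if `st` is defined, then `φ(s)φ(t)` is defined and equals `φ(st)` -/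
  rm1 : ∀ s t r, S.mul s t = some r → T.mul (φ s) (φ t) = some (φ r)
  rm2 : ∀ s, φ (S.plus s) = T.plus (φ s)

/-- Premorphisms between left restriction semigroupoids. -/
structure IsPremorphism (S : LRSemigroupoid α) (T : LRSemigroupoid β) (φ : α → β) : Prop where
  /-- if `st` is defined, then `φ(s)φ(t)` and `φ(s)⁺φ(st)` are defined and equal -/
  pm1 : ∀ s t r, S.mul s t = some r →
    ∃ q, T.mul (φ s) (φ t) = some q ∧ T.mul (T.plus (φ s)) (φ r) = some q
  pm2 : ∀ s, T.NatLE (T.plus (φ s)) (φ (S.plus s))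

end LRSemigroupoid

/-- A left restriction category with set of arrows `α`, that is, a small category
`(objects, α, dom, rng, mul)`, whose objects are identified with their identity arrows, together
with a left restriction structure `plus`.  The composite `fg` is defined iff `dom f = rng g`. -/
@[ext] structure LRCategory (α : Type u) where
  mul : α → α → Option α
  objects : Set α
  dom : α → α
  rng : α → α
  dom_mem : ∀ f, dom f ∈ objects
  rng_mem : ∀ f, rng f ∈ objects
  dom_obj : ∀ e ∈ objects, dom e = e
  rng_obj : ∀ e ∈ objects, rng e = e
  /-- `fg` is defined iff `dom f = rng g` -/
  mul_def : ∀ f g, (∃ h, mul f g = some h) ↔ dom f = rng g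
  dom_mul : ∀ f g h, mul f g = some h → dom h = dom g
  rng_mul : ∀ f g h, mul f g = some h → rng h = rng f
  rng_id : ∀ f, mul (rng f) f = some f
  dom_id : ∀ f, mul f (dom f) = some f
  /-- `(fg)h = f(gh)` whenever `fg` and `gh` are defined -/
  assoc : ∀ f g h a b, mul f g = some a → mul g h = some b → mul a h = mul f b
  plus : α → α
  /-- if `f : A → B`, then `f⁺ : B → B` -/
  dom_plus : ∀ f, dom (plus f) = rng f
  rng_plus : ∀ f, rng (plus f) = rng f
  /-- `f⁺f = f` -/
  r1 : ∀ f, mul (plus f) f = some f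
  /-- `f⁺g⁺ = g⁺f⁺` whenever `rng f = rng g` -/
  r2 : ∀ f g, rng f = rng g → mul (plus f) (plus g) = mul (plus g) (plus f)
  /-- `f⁺g⁺ = (f⁺g)⁺` whenever `rng f = rng g` -/
  r3 : ∀ f g h, rng f = rng g → mul (plus f) g = some h → mul (plus f) (plus g) = some (plus h)
  /-- `fg⁺ = (fg)⁺f` whenever `dom f = rng g` -/
  r4 : ∀ f g h, dom f = rng g → mul f g = some h → mul f (plus g) = mul (plus h) f

/-- A left constellation on the set `α`. -/
@[ext] structure LeftConstellation (α : Type u) where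
  mul : α → α → Option α
  plus : α → α
  /-- `xy` and `yz` are defined iff `yz` and `x(yz)` are defined -/
  c1 : ∀ x y z, ((∃ a, mul x y = some a) ∧ ∃ b, mul y z = some b) ↔
    ∃ b, mul y z = some b ∧ ∃ c, mul x b = some c
  /-- if `xy` and `yz` are defined, then `(xy)z` is defined and `x(yz) = (xy)z` -/
  c2 : ∀ x y z a b, mul x y = some a → mul y z = some b →
    ∃ c, mul a z = some c ∧ mul x b = some c
  /-- for `e ∈ T⁺`: `ex` is defined and equals `x` iff `e = x⁺` -/
  c3 : ∀ e ∈ Set.range plus, ∀ x, mul e x = some x ↔ e = plus x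
  /-- for `e ∈ T⁺`: if `xe` is defined, then `xe = x` -/
  c4 : ∀ e ∈ Set.range plus, ∀ x y, mul x e = some y → y = x

/-- A left constellation with a partial order on its underlying set. -/
@[ext] structure OrderedData (α : Type u) extends LeftConstellation α where
  le : α → α → Prop
  le_refl : ∀ x, le x x
  le_trans : ∀ x y z, le x y → le y z → le x z
  le_antisymm : ∀ x y, le x y → le y x → x = y

namespace OrderedData

variable {α : Type u} (T : OrderedData α)

/-- The set `T⁺ = {x⁺ : x ∈ T}`. -/
def proj : Set α := Set.range T.plus

/-- `xy` is defined. -/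
def Dfd (x y : α) : Prop := ∃ z, T.mul x y = some z

/-- `r` has the two properties required of the restriction `e|x`. -/
def IsRestr (e x r : α) : Prop := T.le r x ∧ T.plus r = e

/-- `r` is the corestriction `x|e`: the maximum element of `{y : y ≤ x and ye is defined}`.
Accordingly `x|e ≠ ∅` is expressed as `∃ r, T.IsCorestr x e r`. -/
def IsCorestr (x e r : α) : Prop :=
  T.le r x ∧ T.Dfd r e ∧ ∀ y, T.le y x → T.Dfd y e → T.le y r

/-- For `e, f ∈ T⁺`: `e` and `f` lie in the same connected component of `(T⁺, ≤)`. -/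
def Connected (e f : α) : Prop :=
  Relation.EqvGen (fun a b => a ∈ T.proj ∧ b ∈ T.proj ∧ T.le a b) e f

/-- `z` is the meet of `e` and `f` in the partially ordered set `(T⁺, ≤)`. -/
def IsMeet (e f z : α) : Prop :=
  z ∈ T.proj ∧ T.le z e ∧ T.le z f ∧ ∀ w ∈ T.proj, T.le w e → T.le w f → T.le w z

/-- `r` is the pseudo-product `x ⊗ y = (x|y⁺)y`, which is defined iff `x|y⁺ ≠ ∅`. -/
def IsPseudo (x y r : α) : Prop :=
  ∃ v, T.IsCorestr x (T.plus y) v ∧ T.mul v y = some r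

/-- `m` is the maximum element of its connected component in `(T⁺, ≤)`. -/
def IsComponentMax (m : α) : Prop :=
  m ∈ T.proj ∧ ∀ f ∈ T.proj, T.Connected m f → T.le f m

/-- Every `x` admits a nonempty corestriction to some `e ∈ T⁺`. -/
def NonDegenerate : Prop := ∀ x, ∃ e ∈ T.proj, ∃ r, T.IsCorestr x e r

/-- Every connected component of `(T⁺, ≤)` has a maximum element. -/
def LocallyComplete : Prop := ∀ e ∈ T.proj, ∃ m, T.Connected e m ∧ T.IsComponentMax m

/-- `T` is locally complete, and `x|1 = x` whenever `1` is the maximum of a connected component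
of `(T⁺, ≤)` and `x|1 ≠ ∅`. -/
def Unitary : Prop :=
  T.LocallyComplete ∧ ∀ m, T.IsComponentMax m → ∀ x r, T.IsCorestr x m r → r = x

end OrderedData

/-- A locally inductive left constellation (li-constellation) on the set `α`. -/
@[ext] structure LiConstellation (α : Type u) extends OrderedData α where
  wo1 : ∀ x x' y y' a b, le x y → le x' y' → mul x x' = some a → mul y y' = some b → le a b
  wo2 : ∀ x y, le x y → le (plus x) (plus y)
  wo3 : ∀ e ∈ toOrderedData.proj, ∀ x, le e (plus x) → ∃! r, toOrderedData.IsRestr e x r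
  /-- `{y : y ≤ x and ye is defined}` is empty or has a maximum element -/
  wo4 : ∀ e ∈ toOrderedData.proj, ∀ x, (∃ y, le y x ∧ toOrderedData.Dfd y e) →
    ∃ r, toOrderedData.IsCorestr x e r
  /-- if `xy` is defined, then `(xy)|e ≠ ∅` iff `y|e ≠ ∅` -/
  wo5 : ∀ e ∈ toOrderedData.proj, ∀ x y z, mul x y = some z →
    ((∃ r, toOrderedData.IsCorestr z e r) ↔ ∃ r, toOrderedData.IsCorestr y e r)
  /-- if `f ≤ e`, then `x|e ≠ ∅` iff `x|f ≠ ∅` -/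
  wo6 : ∀ e ∈ toOrderedData.proj, ∀ f ∈ toOrderedData.proj, le f e → ∀ x,
    ((∃ r, toOrderedData.IsCorestr x e r) ↔ ∃ r, toOrderedData.IsCorestr x f r)
  /-- if `xy` is defined and `(xy)|e ≠ ∅`, then `((xy)|e)⁺ = (x|(y|e)⁺)⁺` -/
  wo7 : ∀ e ∈ toOrderedData.proj, ∀ x y z r s t, mul x y = some z →
    toOrderedData.IsCorestr z e r → toOrderedData.IsCorestr y e s →
    toOrderedData.IsCorestr x (plus s) t → plus r = plus t
  /-- if `e ≤ f` in `T⁺`, then the restriction `e|f` and the corestriction `e|f` coincide -/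
  wo8 : ∀ e ∈ toOrderedData.proj, ∀ f ∈ toOrderedData.proj, le e f →
    ∃ r, toOrderedData.IsRestr e f r ∧ toOrderedData.IsCorestr e f r
  /-- each connected component of `T⁺` is a meet-semilattice with `e ∧ f = e|f` -/
  wo9 : ∀ e ∈ toOrderedData.proj, ∀ f ∈ toOrderedData.proj, toOrderedData.Connected e f →
    ∃ z, toOrderedData.IsMeet e f z ∧ toOrderedData.IsCorestr e f z
  /-- the corestriction `e|f` is defined only for `e, f` in the same connected component -/
  wo9_dom : ∀ e ∈ toOrderedData.proj, ∀ f ∈ toOrderedData.proj, ∀ r,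
    toOrderedData.IsCorestr e f r → toOrderedData.Connected e f

namespace LiConstellation

variable {α β γ : Type u}

/-- Inductive radiants between li-constellations. -/
structure IsRadiant (T : LiConstellation α) (L : LiConstellation β) (φ : α → β) : Prop where
  ir1 : ∀ x y z, T.mul x y = some z → L.mul (φ x) (φ y) = some (φ z)
  ir2 : ∀ x, L.plus (φ x) = φ (T.plus x)
  ir3 : ∀ x y, T.le x y → L.le (φ x) (φ y)
  /-- if `x|e ≠ ∅`, then `φ(x)|φ(e) ≠ ∅` and `φ(x|e) = φ(x)|φ(e)` -/
  ir4 : ∀ x, ∀ e ∈ T.proj, ∀ r, T.IsCorestr x e r → L.IsCorestr (φ x) (φ e) (φ r)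

/-- Inductive preradiants between li-constellations. -/
structure IsPreradiant (T : LiConstellation α) (L : LiConstellation β) (φ : α → β) : Prop where
  /-- if `xy` is defined, then `φ(x) ⊗ φ(y)` and `φ(x)⁺ ⊗ φ(xy)` are defined and equal -/
  ip1 : ∀ x y z, T.mul x y = some z →
    ∃ r, L.IsPseudo (φ x) (φ y) r ∧ L.IsPseudo (L.plus (φ x)) (φ z) r
  ip2 : ∀ x, L.le (L.plus (φ x)) (φ (T.plus x))
  ip3 : ∀ x y, T.le x y → L.le (φ x) (φ y)
  /-- if `x|e ≠ ∅`, then `φ(x)|φ(e) ≠ ∅` and `φ(x|e) = φ(x)|φ(e)` -/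
  ip4 : ∀ x, ∀ e ∈ T.proj, ∀ r, T.IsCorestr x e r → L.IsCorestr (φ x) (φ e) (φ r)
  /-- if `e ≤ x⁺`, then `φ(e|x)⁺` is the corestriction `φ(e)|φ(x)⁺` -/
  ip5 : ∀ x, ∀ e ∈ T.proj, T.le e (T.plus x) → ∀ r, T.IsRestr e x r →
    L.IsCorestr (φ e) (L.plus (φ x)) (L.plus (φ r))

end LiConstellation

/-! ### Left restriction categories are left restriction semigroupoids -/

/-- The left restriction semigroupoid underlying a left restriction category. -/
def LRCategory.toLRSemigroupoid {α : Type u} (C : LRCategory α) : LRSemigroupoid α where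
  mul := C.mul
  s1 s t r a b h1 h2 := by
    have h := C.assoc s t r a b h1 h2
    obtain ⟨c, hc⟩ := (C.mul_def a r).2 ((C.dom_mul _ _ _ h1).trans ((C.mul_def t r).1 ⟨b, h2⟩))
    exact ⟨c, hc, h ▸ hc⟩
  s2 s t r a c h1 h2 := by
    obtain ⟨b, hb⟩ := (C.mul_def t r).2 ((C.dom_mul _ _ _ h1).symm.trans ((C.mul_def a r).1 ⟨c, h2⟩))
    exact ⟨b, hb, (C.assoc s t r a b h1 hb) ▸ h2⟩
  s3 s t r b c h1 h2 := by
    obtain ⟨a, ha⟩ := (C.mul_def s t).2 (((C.mul_def s b).1 ⟨c, h2⟩).trans (C.rng_mul _ _ _ h1))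
    exact ⟨a, ha, (C.assoc s t r a b ha h1).trans h2⟩
  plus := C.plus
  lr1 := C.r1
  lr2 s t := by
    by_cases h : C.rng s = C.rng t
    · exact C.r2 s t h
    · have aux : ∀ f g, C.rng f ≠ C.rng g → C.mul (C.plus f) (C.plus g) = none := by
        intro f g hfg
        rw [Option.eq_none_iff_forall_ne_some]
        intro k hk
        have := (C.mul_def _ _).1 ⟨k, hk⟩
        rw [C.dom_plus, C.rng_plus] at this
        exact hfg this
      rw [aux s t h, aux t s (Ne.symm h)]
  lr3 s t r h := by
    have h' := (C.mul_def _ _).1 ⟨r, h⟩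
    rw [C.dom_plus] at h'
    exact C.r3 s t r h' h
  lr4 s t r h := by
    have h' := (C.mul_def _ _).1 ⟨r, h⟩
    obtain ⟨q, hq⟩ := (C.mul_def s (C.plus t)).2 (by rw [C.rng_plus]; exact h')
    exact ⟨q, hq, (C.r4 s t r h' h) ▸ hq⟩

/-! ### Closure of the four kinds of maps under identities and composition -/

namespace LRSemigroupoid

variable {α β γ : Type u}

theorem IsRestrictionMorphism.id (S : LRSemigroupoid α) : IsRestrictionMorphism S S (fun x => x) :=
  ⟨fun _ _ _ h => h, fun _ => rfl⟩

theorem IsRestrictionMorphism.comp {S : LRSemigroupoid α} {T : LRSemigroupoid β}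
    {L : LRSemigroupoid γ} {φ : α → β} {ψ : β → γ} (hφ : IsRestrictionMorphism S T φ)
    (hψ : IsRestrictionMorphism T L ψ) : IsRestrictionMorphism S L (fun x => ψ (φ x)) :=
  ⟨fun _ _ _ h => hψ.rm1 _ _ _ (hφ.rm1 _ _ _ h), fun s => by rw [hφ.rm2, hψ.rm2]⟩

theorem plus_mul_plus (S : LRSemigroupoid α) (s : α) :
    S.mul (S.plus s) (S.plus s) = some (S.plus s) := S.lr3 s s s (S.lr1 s)

theorem plus_plus (S : LRSemigroupoid α) (s : α) : S.plus (S.plus s) = S.plus s := by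
  have h2 := S.lr3 s (S.plus s) _ (S.plus_mul_plus s)
  rw [S.lr2 s (S.plus s), S.lr1] at h2
  exact (Option.some.inj h2).symm

theorem natLE_trans (S : LRSemigroupoid α) {a b c : α} (h1 : S.NatLE a b) (h2 : S.NatLE b c) :
    S.NatLE a c := by
  obtain ⟨d, hd1, hd2⟩ := S.s3 _ _ _ _ _ h2 h1
  rw [S.lr3 _ _ _ h1] at hd1
  obtain rfl := Option.some.inj hd1
  exact hd2

/-- If `s ≤ t` and `ta = b`, then `sa` is defined and equals `s⁺b`. -/
theorem natLE_mul (S : LRSemigroupoid α) {s t a b : α} (h : S.NatLE s t)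
    (hb : S.mul t a = some b) : ∃ c, S.mul s a = some c ∧ S.mul (S.plus s) b = some c :=
  S.s1 _ _ _ _ _ h hb

theorem natLE_plus (S : LRSemigroupoid α) {s t : α} (h : S.NatLE s t) :
    S.NatLE (S.plus s) (S.plus t) := by
  have := S.lr3 _ _ _ h
  unfold NatLE
  rwa [S.plus_plus]

theorem IsPremorphism.plus_image {S : LRSemigroupoid α} {T : LRSemigroupoid β} {φ : α → β}
    (h : IsPremorphism S T φ) (s : α) : T.plus (φ (S.plus s)) = φ (S.plus s) := by
  have h1 := h.pm2 (S.plus s)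
  unfold NatLE at h1
  rw [S.plus_plus, T.plus_plus, T.lr1] at h1
  exact (Option.some.inj h1).symm

/-- Premorphisms are order preserving. -/
theorem IsPremorphism.mono {S : LRSemigroupoid α} {T : LRSemigroupoid β} {φ : α → β}
    (h : IsPremorphism S T φ) {s t : α} (hst : S.NatLE s t) : T.NatLE (φ s) (φ t) := by
  obtain ⟨q, h1, h2⟩ := h.pm1 _ _ _ hst
  rw [h.plus_image] at h2
  have h3 := h.pm2 s
  obtain ⟨c, hc, hc'⟩ := T.natLE_mul h3 h1
  obtain ⟨d, hd, hd'⟩ := T.natLE_mul h3 h2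
  rw [hd'] at hc'
  rw [T.lr1] at hd
  unfold NatLE
  rw [hc, ← hc', ← hd]

theorem IsPremorphism.id (S : LRSemigroupoid α) : IsPremorphism S S (fun x => x) := by
  refine ⟨fun s t r h => ⟨r, h, ?_⟩, fun s => S.lr1 _⟩
  obtain ⟨c, hc, hc'⟩ := S.s1 _ _ _ _ _ (S.lr1 s) h
  rw [hc']
  rw [← hc, h]

theorem IsPremorphism.comp {S : LRSemigroupoid α} {T : LRSemigroupoid β}
    {L : LRSemigroupoid γ} {φ : α → β} {ψ : β → γ} (hφ : IsPremorphism S T φ)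
    (hψ : IsPremorphism T L ψ) : IsPremorphism S L (fun x => ψ (φ x)) := by
  refine ⟨fun s t r h => ?_, fun s => ?_⟩
  · obtain ⟨q, h1, h2⟩ := hφ.pm1 _ _ _ h
    obtain ⟨a, ha1, ha2⟩ := hψ.pm1 _ _ _ h1
    obtain ⟨b, hb1, hb2⟩ := hψ.pm1 _ _ _ h2
    rw [hψ.plus_image] at hb2
    have h3 := hψ.pm2 (φ s)
    obtain ⟨c, hc, hc'⟩ := L.natLE_mul h3 hb1
    obtain ⟨d, hd, hd'⟩ := L.natLE_mul h3 hb2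
    refine ⟨a, ha1, ?_⟩
    rw [hd'] at hc'
    rw [hc, ← hc', ← hd, ha2]
  · exact L.natLE_trans (hψ.pm2 (φ s)) (hψ.mono (hφ.pm2 s))

end LRSemigroupoid

namespace OrderedData

variable {α : Type u} (T : OrderedData α)

theorem plus_mem (x : α) : T.plus x ∈ T.proj := ⟨x, rfl⟩

theorem plus_mul (x : α) : T.mul (T.plus x) x = some x := (T.c3 _ (T.plus_mem x) x).2 rfl

theorem proj_mul {e : α} (he : e ∈ T.proj) : T.mul e e = some e := by
  obtain ⟨x, rfl⟩ := he
  have h1 := T.plus_mul x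
  obtain ⟨⟨a, ha⟩, -⟩ := (T.c1 (T.plus x) (T.plus x) x).2 ⟨x, h1, x, h1⟩
  rw [ha, T.c4 _ (T.plus_mem x) _ _ ha]

theorem proj_plus {e : α} (he : e ∈ T.proj) : T.plus e = e :=
  ((T.c3 e he e).1 (T.proj_mul he)).symm

theorem plus_plus (x : α) : T.plus (T.plus x) = T.plus x := T.proj_plus (T.plus_mem x)

theorem plus_of_mul {x y z : α} (h : T.mul x y = some z) : T.plus z = T.plus x := by
  obtain ⟨c, h1, h2⟩ := T.c2 _ _ _ _ _ (T.plus_mul x) h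
  rw [h] at h1
  obtain rfl := Option.some.inj h1
  exact ((T.c3 _ (T.plus_mem x) _).1 h2).symm

theorem dfd_plus (x y : α) : T.Dfd x (T.plus y) ↔ T.Dfd x y := by
  have h := T.c1 x (T.plus y) y
  constructor
  · intro h1
    obtain ⟨b, hb, hc⟩ := h.1 ⟨h1, y, T.plus_mul y⟩
    rw [T.plus_mul y] at hb
    obtain rfl := Option.some.inj hb
    exact hc
  · intro h1
    exact (h.2 ⟨y, T.plus_mul y, h1⟩).1

variable {T}

theorem IsCorestr.unique {x e r r' : α} (h : T.IsCorestr x e r) (h' : T.IsCorestr x e r') :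
    r = r' :=
  T.le_antisymm _ _ (h'.2.2 _ h.1 h.2.1) (h.2.2 _ h'.1 h'.2.1)

theorem IsPseudo.unique {x y r r' : α} (h : T.IsPseudo x y r) (h' : T.IsPseudo x y r') :
    r = r' := by
  obtain ⟨v, h1, h2⟩ := h
  obtain ⟨w, h3, h4⟩ := h'
  obtain rfl := h1.unique h3
  rw [h2] at h4
  exact Option.some.inj h4

theorem isCorestr_of_dfd {x e : α} (h : T.Dfd x e) : T.IsCorestr x e x :=
  ⟨T.le_refl x, h, fun _ hy _ => hy⟩

theorem isPseudo_of_mul {x y z : α} (h : T.mul x y = some z) : T.IsPseudo x y z :=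
  ⟨x, isCorestr_of_dfd ((T.dfd_plus x y).2 ⟨z, h⟩), h⟩

end OrderedData

namespace LiConstellation

open OrderedData

variable {α β γ : Type u} (T : LiConstellation α)

/-- If `x ≤ y`, then `x⁺y` is defined and equals `x`. -/
theorem plus_mul_of_le {x y : α} (h : T.le x y) : T.mul (T.plus x) y = some x := by
  have h1 := T.wo2 _ _ h
  obtain ⟨u, hu, hu'⟩ := T.wo8 _ (T.plus_mem x) _ (T.plus_mem y) h1
  obtain ⟨w0, hw0, hun⟩ := T.wo3 _ (T.plus_mem x) (T.plus y) (by rwa [T.plus_plus])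
  have e1 : u = T.plus x := (hun _ hu).trans (hun _ ⟨h1, T.plus_plus x⟩).symm
  rw [e1] at hu'
  obtain ⟨w, hw⟩ := (T.dfd_plus _ _).1 hu'.2.1
  have hwy := T.wo1 _ _ _ _ _ _ h1 (T.le_refl y) hw (T.plus_mul y)
  obtain ⟨v, -, hv⟩ := T.wo3 _ (T.plus_mem x) y h1
  have e2 : w = x := (hv _ ⟨hwy, (T.plus_of_mul hw).trans (T.plus_plus x)⟩).trans
    (hv _ ⟨h, rfl⟩).symm
  rw [hw, e2]

theorem dfd_mono {y e f : α} (he : e ∈ T.proj) (hef : T.le e f) (h : T.Dfd y e) : T.Dfd y f := by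
  obtain ⟨a, ha⟩ := h
  have h1 := T.plus_mul_of_le hef
  rw [T.proj_plus he] at h1
  obtain ⟨c, hc, -⟩ := T.c2 _ _ _ _ _ ha h1
  rw [T.c4 e he _ _ ha] at hc
  exact ⟨c, hc⟩

/-- If `e ≤ f`, then `(x|f)|e = x|e`. -/
theorem corestr_corestr {x e f v w : α} (he : e ∈ T.proj) (hef : T.le e f)
    (hv : T.IsCorestr x f v) (hw : T.IsCorestr x e w) : T.IsCorestr v e w :=
  ⟨hv.2.2 _ hw.1 (T.dfd_mono he hef hw.2.1), hw.2.1,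
    fun _ hy hye => hw.2.2 _ (T.le_trans _ _ _ hy hv.1) hye⟩

theorem pseudo_s1 {x y z a b : α} (h1 : T.IsPseudo x y a) (h2 : T.IsPseudo y z b) :
    ∃ c, T.IsPseudo a z c ∧ T.IsPseudo x b c := by
  obtain ⟨r, hr, ha⟩ := h1
  obtain ⟨v, hv, hb⟩ := h2
  have hvy := T.wo2 _ _ hv.1
  have hbv := T.plus_of_mul hb
  obtain ⟨w, hw⟩ := (T.wo6 _ (T.plus_mem y) _ (T.plus_mem v) hvy x).1 ⟨r, hr⟩
  have hrw := T.corestr_corestr (T.plus_mem v) hvy hr hw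
  obtain ⟨t, ht⟩ := (T.wo5 _ (T.plus_mem z) _ _ _ ha).2 ⟨v, hv⟩
  have htw := T.wo7 _ (T.plus_mem z) _ _ _ _ _ _ ha ht hv hrw
  obtain ⟨p, hp⟩ := (T.dfd_plus _ _).1 hw.2.1
  obtain ⟨c, hc1, hc2⟩ := T.c2 _ _ _ _ _ hp hb
  have hta := T.plus_mul_of_le ht.1
  rw [htw] at hta
  obtain ⟨q, hq⟩ := hw.2.1
  have hq' := T.c4 _ (T.plus_mem v) _ _ hq
  subst hq'
  obtain ⟨d, hd1, hd2⟩ := T.c2 _ _ _ _ _ hq (T.plus_mul_of_le hv.1)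
  rw [hp] at hd2
  obtain rfl := Option.some.inj hd2
  obtain ⟨g, hg1, hg2⟩ := T.c2 _ _ _ _ _ (T.plus_mul_of_le hrw.1) ha
  rw [hd1] at hg1
  obtain rfl := Option.some.inj hg1
  rw [hta] at hg2
  obtain rfl := Option.some.inj hg2
  exact ⟨c, ⟨_, ht, hc1⟩, ⟨_, by rw [hbv]; exact hw, hc2⟩⟩

theorem pseudo_dfd {x y : α} : (∃ r, T.IsCorestr x (T.plus y) r) ↔ ∃ z, T.IsPseudo x y z := by
  constructor
  · rintro ⟨r, hr⟩
    obtain ⟨z, hz⟩ := (T.dfd_plus _ _).1 hr.2.1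
    exact ⟨z, r, hr, hz⟩
  · rintro ⟨z, r, hr, -⟩
    exact ⟨r, hr⟩

theorem pseudo_proj {e f r : α} (hf : f ∈ T.proj) : T.IsPseudo e f r ↔ T.IsCorestr e f r := by
  constructor
  · rintro ⟨v, hv, hr⟩
    obtain rfl := T.c4 f hf _ _ hr
    rwa [T.proj_plus hf] at hv
  · intro h
    obtain ⟨q, hq⟩ := h.2.1
    have := T.c4 f hf _ _ hq
    subst this
    exact ⟨_, by rwa [T.proj_plus hf], hq⟩

theorem corestr_proj {e f r : α} (he : e ∈ T.proj) (hf : f ∈ T.proj) (h : T.IsCorestr e f r) :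
    T.IsMeet e f r ∧ T.IsCorestr f e r := by
  have hc := T.wo9_dom _ he _ hf _ h
  obtain ⟨z, hz, hz'⟩ := T.wo9 _ he _ hf hc
  obtain ⟨w, hw, hw'⟩ := T.wo9 _ hf _ he (hc.symm _ _)
  obtain rfl := h.unique hz'
  have : w = r := T.le_antisymm _ _ (hz.2.2.2 _ hw.1 hw.2.2.1 hw.2.1)
    (hw.2.2.2 _ hz.1 hz.2.2.1 hz.2.1)
  subst this
  exact ⟨hz, hw'⟩

open Classical in
/-- The pseudo-product as a partial operation. -/
noncomputable def pmul (x y : α) : Option α :=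
  if h : ∃ r, T.IsPseudo x y r then some h.choose else none

theorem pmul_eq {x y r : α} : T.pmul x y = some r ↔ T.IsPseudo x y r := by
  unfold pmul
  split_ifs with h
  · rw [Option.some.injEq]
    exact ⟨fun e => e ▸ h.choose_spec, fun e => h.choose_spec.unique e⟩
  · simp only [false_iff]
    exact fun e => h ⟨r, e⟩

/-- The left restriction semigroupoid of a li-constellation, under the pseudo-product. -/
noncomputable def toLRSemigroupoid : LRSemigroupoid α where
  mul := T.pmul
  plus := T.plus
  s1 s t r a b h1 h2 := by
    simp only [pmul_eq] at *
    exact T.pseudo_s1 h1 h2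
  s2 s t r a c h1 h2 := by
    simp only [pmul_eq] at *
    obtain ⟨v, hv, ha⟩ := id h1
    obtain ⟨b, hb⟩ := T.pseudo_dfd.1
      ((T.wo5 _ (T.plus_mem r) _ _ _ ha).1 (T.pseudo_dfd.2 ⟨c, h2⟩))
    obtain ⟨d, hd1, hd2⟩ := T.pseudo_s1 h1 hb
    obtain rfl := hd1.unique h2
    exact ⟨b, hb, hd2⟩
  s3 s t r b c h1 h2 := by
    simp only [pmul_eq] at *
    obtain ⟨v, hv, hb⟩ := id h1
    have h3 := T.pseudo_dfd.2 ⟨c, h2⟩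
    rw [T.plus_of_mul hb] at h3
    obtain ⟨a, ha⟩ := T.pseudo_dfd.1
      ((T.wo6 _ (T.plus_mem t) _ (T.plus_mem v) (T.wo2 _ _ hv.1) s).2 h3)
    obtain ⟨d, hd1, hd2⟩ := T.pseudo_s1 ha h1
    obtain rfl := hd2.unique h2
    exact ⟨a, ha, hd1⟩
  lr1 s := T.pmul_eq.2 (isPseudo_of_mul (T.plus_mul s))
  lr2 s t := by
    ext r
    simp only [pmul_eq, T.pseudo_proj (T.plus_mem _)]
    exact ⟨fun h => (T.corestr_proj (T.plus_mem _) (T.plus_mem _) h).2,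
      fun h => (T.corestr_proj (T.plus_mem _) (T.plus_mem _) h).2⟩
  lr3 s t r h := by
    simp only [pmul_eq, T.pseudo_proj (T.plus_mem _)] at *
    obtain ⟨v, hv, hr⟩ := h
    rw [T.plus_of_mul hr, T.proj_plus (T.corestr_proj (T.plus_mem _) (T.plus_mem _) hv).1.1]
    exact hv
  lr4 s t r h := by
    simp only [pmul_eq, T.pseudo_proj (T.plus_mem _)] at *
    obtain ⟨v, hv, hr⟩ := h
    refine ⟨v, hv, ?_⟩
    rw [T.plus_of_mul hr]
    exact isPseudo_of_mul (T.plus_mul_of_le hv.1)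

theorem mul_eq {x y r : α} : T.toLRSemigroupoid.mul x y = some r ↔ T.IsPseudo x y r := T.pmul_eq

theorem natLE_iff {x y : α} : T.toLRSemigroupoid.NatLE x y ↔ T.le x y := by
  refine T.mul_eq.trans ⟨?_, fun h => isPseudo_of_mul (T.plus_mul_of_le h)⟩
  rintro ⟨v, hv, hx⟩
  exact T.wo1 _ _ _ _ _ _ (T.corestr_proj (T.plus_mem _) (T.plus_mem _) hv).1.2.2.1 (T.le_refl y)
    hx (T.plus_mul y)

theorem IsRadiant.map_proj {T : LiConstellation α} {L : LiConstellation β} {φ : α → β}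
    (h : IsRadiant T L φ) {e : α} (he : e ∈ T.proj) : φ e ∈ L.proj := by
  obtain ⟨x, rfl⟩ := he
  exact ⟨φ x, h.ir2 x⟩

theorem IsRadiant.id (T : LiConstellation α) : IsRadiant T T (fun x => x) :=
  ⟨fun _ _ _ h => h, fun _ => rfl, fun _ _ h => h, fun _ _ _ _ h => h⟩

theorem IsRadiant.comp {T : LiConstellation α} {L : LiConstellation β} {M : LiConstellation γ}
    {φ : α → β} {ψ : β → γ} (hφ : IsRadiant T L φ) (hψ : IsRadiant L M ψ) :
    IsRadiant T M (fun x => ψ (φ x)) :=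
  ⟨fun _ _ _ h => hψ.ir1 _ _ _ (hφ.ir1 _ _ _ h), fun x => by rw [hψ.ir2, hφ.ir2],
    fun _ _ h => hψ.ir3 _ _ (hφ.ir3 _ _ h),
    fun _ _ he _ h => hψ.ir4 _ _ (hφ.map_proj he) _ (hφ.ir4 _ _ he _ h)⟩

theorem IsPreradiant.map_proj {T : LiConstellation α} {L : LiConstellation β} {φ : α → β}
    (h : IsPreradiant T L φ) {e : α} (he : e ∈ T.proj) : φ e ∈ L.proj := by
  have h1 := h.ip2 e
  rw [T.proj_plus he] at h1
  have h2 := L.plus_mul_of_le h1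
  rw [L.plus_plus, L.plus_mul] at h2
  exact ⟨φ e, (Option.some.inj h2).symm⟩

theorem IsPreradiant.id (T : LiConstellation α) : IsPreradiant T T (fun x => x) := by
  refine ⟨fun x y z h => ⟨z, isPseudo_of_mul h, isPseudo_of_mul ?_⟩, fun _ => T.le_refl _,
    fun _ _ h => h, fun _ _ _ _ h => h, fun x e he hex r hr => ?_⟩
  · rw [← T.plus_of_mul h]
    exact T.plus_mul z
  · rw [hr.2]
    apply isCorestr_of_dfd
    have := T.plus_mul_of_le hex
    rw [T.proj_plus he] at this
    exact ⟨_, this⟩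

theorem IsPreradiant.map_plus_mul {T : LiConstellation α} {L : LiConstellation β} {φ : α → β}
    (h : IsPreradiant T L φ) (x : α) :
    L.toLRSemigroupoid.mul (φ (T.plus x)) (φ x) = some (φ x) := by
  have h1 : L.toLRSemigroupoid.NatLE (L.plus (φ x)) (φ (T.plus x)) := L.natLE_iff.2 (h.ip2 x)
  have h2 := L.toLRSemigroupoid.lr3 _ _ _ h1
  rw [L.toLRSemigroupoid.lr2] at h2
  change L.toLRSemigroupoid.mul (L.plus (φ (T.plus x))) (L.plus (L.plus (φ x))) =
    some (L.plus (L.plus (φ x))) at h2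
  rw [L.plus_plus, L.proj_plus (h.map_proj (T.plus_mem x))] at h2
  obtain ⟨c, hc, hc'⟩ := L.toLRSemigroupoid.s1 _ _ _ _ _ h2 (L.toLRSemigroupoid.lr1 (φ x))
  have h3 := L.toLRSemigroupoid.lr1 (φ x)
  change L.toLRSemigroupoid.mul (L.plus (φ x)) (φ x) = some (φ x) at h3
  rw [hc']
  rw [h3] at hc
  exact hc.symm

/-- An inductive preradiant is a premorphism with respect to the pseudo-products. -/
theorem IsPreradiant.isPremorphism {T : LiConstellation α} {L : LiConstellation β} {φ : α → β}
    (h : IsPreradiant T L φ) :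
    LRSemigroupoid.IsPremorphism T.toLRSemigroupoid L.toLRSemigroupoid φ := by
  refine ⟨fun s t r hr => ?_, fun s => L.natLE_iff.2 (h.ip2 s)⟩
  obtain ⟨v, hv, hr⟩ := T.mul_eq.1 hr
  obtain ⟨q, hq1, hq2⟩ := h.ip1 _ _ _ hr
  have h1 := L.mul_eq.2 hq1
  have h2 := L.mul_eq.2 hq2
  have h3 := L.mul_eq.2 ((L.pseudo_proj (h.map_proj (T.plus_mem t))).2
    (h.ip4 _ _ (T.plus_mem t) _ hv))
  have h5 := h.ip5 s _ (T.plus_mem v) (T.wo2 _ _ hv.1) v ⟨hv.1, rfl⟩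
  have h6 := (L.mul_eq.2 ((L.pseudo_proj (h.map_proj (T.plus_mem v))).2
    (L.corestr_proj (h.map_proj (T.plus_mem v)) (L.plus_mem _) h5).2))
  obtain ⟨b, hb, hb'⟩ := L.toLRSemigroupoid.s2 _ _ _ _ _ h3 h1
  obtain ⟨d, hd, hd'⟩ := L.toLRSemigroupoid.s2 _ _ _ _ _ h6 h2
  rw [h.map_plus_mul] at hb
  obtain rfl := Option.some.inj hb
  rw [← T.plus_of_mul hr, h.map_plus_mul] at hd
  obtain rfl := Option.some.inj hd
  exact ⟨q, hb', hd'⟩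

theorem IsPreradiant.comp {T : LiConstellation α} {L : LiConstellation β} {M : LiConstellation γ}
    {φ : α → β} {ψ : β → γ} (hφ : IsPreradiant T L φ) (hψ : IsPreradiant L M ψ) :
    IsPreradiant T M (fun x => ψ (φ x)) := by
  refine ⟨fun x y z h => ?_, fun x => M.le_trans _ _ _ (hψ.ip2 _) (hψ.ip3 _ _ (hφ.ip2 x)),
    fun _ _ h => hψ.ip3 _ _ (hφ.ip3 _ _ h),
    fun _ _ he _ h => hψ.ip4 _ _ (hφ.map_proj he) _ (hφ.ip4 _ _ he _ h),
    fun x e he hex u hu => ?_⟩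
  · obtain ⟨q, h1, h2⟩ := (hφ.isPremorphism.comp hψ.isPremorphism).pm1 _ _ _
      (T.mul_eq.2 (isPseudo_of_mul h))
    exact ⟨q, M.mul_eq.1 h1, M.mul_eq.1 h2⟩
  · have h1 := hφ.ip3 _ _ hu.1
    have h2 := hψ.ip5 (φ x) _ (L.plus_mem (φ u)) (L.wo2 _ _ h1) (φ u) ⟨h1, rfl⟩
    have h3 := hψ.ip4 _ _ (L.plus_mem (φ x)) _ (hφ.ip5 x e he hex u hu)
    have h4 := hψ.ip2 (φ x)
    obtain ⟨w, hw⟩ := (M.wo6 _ (hψ.map_proj (L.plus_mem (φ x))) _ (M.plus_mem (ψ (φ x))) h4 _).1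
      ⟨_, h3⟩
    have h5 := M.corestr_corestr (M.plus_mem _) h4 h3 hw
    obtain rfl := h5.unique h2
    exact hw

end LiConstellation

/-! ### The four categories -/

/-- Left restriction categories, as objects of the category with restriction morphisms. -/
@[ext] structure LRCatRestr : Type (u + 1) where
  carrier : Type u
  str : LRCategory carrier

/-- Left restriction categories, as objects of the category with premorphisms. -/
@[ext] structure LRCatPre : Type (u + 1) where
  carrier : Type u
  str : LRCategory carrier

/-- Non-degenerate unitary li-constellations, as objects of the category with inductive
radiants. -/
structure NDULiConstRad : Type (u + 1) where
  carrier : Type u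
  str : LiConstellation carrier
  nonDegenerate : str.NonDegenerate
  unitary : str.Unitary

/-- Non-degenerate unitary li-constellations, as objects of the category with inductive
preradiants. -/
structure NDULiConstPrerad : Type (u + 1) where
  carrier : Type u
  str : LiConstellation carrier
  nonDegenerate : str.NonDegenerate
  unitary : str.Unitary

instance : Category.{u} LRCatRestr.{u} where
  Hom C D := {φ : C.carrier → D.carrier //
    LRSemigroupoid.IsRestrictionMorphism C.str.toLRSemigroupoid D.str.toLRSemigroupoid φ}
  id C := ⟨fun x => x, LRSemigroupoid.IsRestrictionMorphism.id C.str.toLRSemigroupoid⟩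
  comp φ ψ := ⟨fun x => ψ.1 (φ.1 x), φ.2.comp ψ.2⟩

instance : Category.{u} LRCatPre.{u} where
  Hom C D := {φ : C.carrier → D.carrier //
    LRSemigroupoid.IsPremorphism C.str.toLRSemigroupoid D.str.toLRSemigroupoid φ}
  id C := ⟨fun x => x, LRSemigroupoid.IsPremorphism.id C.str.toLRSemigroupoid⟩
  comp φ ψ := ⟨fun x => ψ.1 (φ.1 x), φ.2.comp ψ.2⟩

instance : Category.{u} NDULiConstRad.{u} where
  Hom T L := {φ : T.carrier → L.carrier // LiConstellation.IsRadiant T.str L.str φ}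
  id T := ⟨fun x => x, LiConstellation.IsRadiant.id T.str⟩
  comp φ ψ := ⟨fun x => ψ.1 (φ.1 x), φ.2.comp ψ.2⟩

instance : Category.{u} NDULiConstPrerad.{u} where
  Hom T L := {φ : T.carrier → L.carrier // LiConstellation.IsPreradiant T.str L.str φ}
  id T := ⟨fun x => x, LiConstellation.IsPreradiant.id T.str⟩
  comp φ ψ := ⟨fun x => ψ.1 (φ.1 x), φ.2.comp ψ.2⟩

/-- `A` and `B` are isomorphic categories: there are mutually inverse functors between them
(inverse on the nose, not just up to natural isomorphism). -/
def IsomorphicCategories (A B : Type (u + 1)) [Category.{u} A] [Category.{u} B] : Prop :=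
  ∃ (F : A ⥤ B) (G : B ⥤ A), F ⋙ G = 𝟭 A ∧ G ⋙ F = 𝟭 B

end ESN

/-! Both constructions keep the set of arrows and the map `plus`, and morphisms keep their
underlying functions; only the product is exchanged. From a category to a constellation, the product
`st` is kept only when `st⁺ = s`, and the order is the natural one. Corestriction by a projection is
then multiplication by it (`LRSemigroupoid.isCorestr_iff`), so the pseudo-product `(x|y⁺)y` is
`(xy⁺)y = xy` and returns the original product (`LRSemigroupoid.isPseudo_iff`).

In the other direction the product is the pseudo-product, and objects must be recovered. In a
category every projection over `B` lies below the identity of `B`, and the natural order preserves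
ranges, so identities are exactly the maxima of the components of the projections
(`LRCategory.isComponentMax_iff`). In a li-constellation, non-degeneracy and unitarity give each `x`
a unique component maximum `m` with `x|m = x`: this is the domain of `x`, and the range is the
domain of `x⁺`.

Morphisms are compared on constellations that come from categories, where both kinds of conditions
become equations in the product and `plus`. The round trips on objects are equalities, so this
comparison transfers to arbitrary objects, and the functors are strictly inverse. -/

namespace ESN

/-! ### Projections and the natural order in a left restriction semigroupoid -/

namespace LRSemigroupoid

variable {α β : Type u} (S : LRSemigroupoid α)

/-- `s⁺(st) = st`. -/
theorem plus_mul_mul {s t r : α} (h : S.mul s t = some r) :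
    S.mul (S.plus s) r = some r := by
  obtain ⟨c, hc, hc'⟩ := S.s1 _ _ _ _ _ (S.lr1 s) h
  rw [h] at hc
  rw [hc', hc]

/-- `(st⁺)⁺ = (st)⁺`. -/
theorem plus_mul_plus_eq {s t r q : α} (h : S.mul s t = some r)
    (hq : S.mul s (S.plus t) = some q) : S.plus q = S.plus r := by
  obtain ⟨q', h1, h2⟩ := S.lr4 _ _ _ h
  rw [hq] at h1
  obtain rfl := Option.some.inj h1
  -- Compute `r⁺s⁺` twice: it is `(r⁺s)⁺ = q⁺`, and it is `s⁺r⁺ = (s⁺r)⁺ = r⁺`.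
  have h3 := S.lr3 _ _ _ h2
  rw [S.lr2, S.lr3 _ _ _ (S.plus_mul_mul h)] at h3
  exact (Option.some.inj h3).symm

/-- `(st)⁺ ≤ s⁺`. -/
theorem plus_le_of_mul {s t r : α} (h : S.mul s t = some r) :
    S.NatLE (S.plus r) (S.plus s) := by
  unfold NatLE
  rw [S.plus_plus, S.lr2]
  exact S.lr3 _ _ _ (S.plus_mul_mul h)

theorem natLE_refl (s : α) : S.NatLE s s := S.lr1 s

/-- The product `s⁺t⁺` equals both `s⁺` and `t⁺`, hence `s = s⁺t = t⁺t = t`. -/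
theorem natLE_antisymm {s t : α} (h1 : S.NatLE s t) (h2 : S.NatLE t s) : s = t := by
  have h3 := S.lr3 _ _ _ h1
  rw [S.lr2, S.lr3 _ _ _ h2] at h3
  have h4 : S.mul (S.plus s) t = some s := h1
  rw [← Option.some.inj h3, S.lr1] at h4
  exact (Option.some.inj h4).symm

/-- `t⁺s = s` whenever `s⁺ ≤ t⁺`. -/
theorem proj_mul_of_natLE {s t : α} (h : S.NatLE (S.plus s) (S.plus t)) :
    S.mul (S.plus t) s = some s := by
  unfold NatLE at h
  rw [S.plus_plus, S.lr2] at h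
  obtain ⟨c, hc, hc'⟩ := S.s1 _ _ _ _ _ h (S.lr1 s)
  rw [S.lr1] at hc
  rw [hc', hc]

theorem natLE_proj_left {e f : α} (he : S.plus e = e) : S.NatLE e f ↔ S.mul e f = some e := by
  unfold NatLE
  rw [he]

/-- `se ≤ s` for a projection `e`. -/
theorem mul_proj_natLE {s e r : α} (he : S.plus e = e) (h : S.mul s e = some r) :
    S.NatLE r s := by
  obtain ⟨q, h1, h2⟩ := S.lr4 _ _ _ h
  rw [he, h] at h1
  obtain rfl := Option.some.inj h1
  exact h2

/-- `es ≤ s` for a projection `e`. -/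
theorem proj_mul_natLE {s e r : α} (he : S.plus e = e) (h : S.mul e s = some r) :
    S.NatLE r s := by
  have h3 := S.lr3 e s r (by rw [he]; exact h)
  rw [he] at h3
  unfold NatLE
  obtain ⟨b, hb, hb'⟩ := S.s3 _ _ _ _ _ (S.lr1 s) h
  rw [h3] at hb
  obtain rfl := Option.some.inj hb
  exact hb'

theorem proj_mul_proj {e : α} (he : S.plus e = e) : S.mul e e = some e := by
  have := S.lr1 e
  rwa [he] at this

theorem proj_mul_comm {e f : α} (he : S.plus e = e) (hf : S.plus f = f) :
    S.mul e f = S.mul f e := by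
  have := S.lr2 e f
  rwa [he, hf] at this

theorem plus_proj_mul_proj {e f r : α} (he : S.plus e = e) (hf : S.plus f = f)
    (h : S.mul e f = some r) : S.plus r = r := by
  have h3 := S.lr3 e f r (by rw [he]; exact h)
  rw [he, hf, h] at h3
  exact (Option.some.inj h3).symm

/-! ### The constellation product and its pseudo-product -/

open Classical in
/-- The constellation product: the product `st`, restricted to those pairs with `st⁺ = s`. -/
noncomputable def cmul (s t : α) : Option α :=
  if S.mul s (S.plus t) = some s then S.mul s t else none

theorem cmul_eq {s t r : α} :
    S.cmul s t = some r ↔ S.mul s (S.plus t) = some s ∧ S.mul s t = some r := by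
  unfold cmul
  split_ifs with h <;> simp [h]

/-- The condition `st⁺ = s` already makes `st` defined, because `t⁺t` is defined. Definedness thus
depends on `t` only through `t⁺`. -/
theorem exists_cmul {s t : α} : (∃ r, S.cmul s t = some r) ↔ S.mul s (S.plus t) = some s := by
  constructor
  · rintro ⟨r, hr⟩
    exact (S.cmul_eq.1 hr).1
  · intro h
    obtain ⟨b, hb, -⟩ := S.s2 _ _ _ _ _ (S.lr1 s) h
    obtain ⟨r, hr, -⟩ := S.s1 _ _ _ _ _ h (S.lr1 t)
    exact ⟨r, S.cmul_eq.2 ⟨h, hr⟩⟩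

/-- Here `(st)⁺ = (st⁺)⁺ = s⁺`. With `exists_cmul` this yields axiom `c1`: multiplying `y` by `z` on
the right does not change which `x` compose with it. -/
theorem plus_of_cmul {s t r : α} (h : S.cmul s t = some r) : S.plus r = S.plus s :=
  (S.plus_mul_plus_eq (S.cmul_eq.1 h).2 (S.cmul_eq.1 h).1).symm

theorem mul_of_proj_cmul {s e r : α} (he : S.plus e = e) (h : S.cmul s e = some r) :
    r = s ∧ S.mul s e = some s := by
  obtain ⟨h1, h2⟩ := S.cmul_eq.1 h
  rw [he] at h1
  rw [h1] at h2
  exact ⟨(Option.some.inj h2).symm, h1⟩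

theorem exists_cmul_proj {s e : α} (he : S.plus e = e) :
    (∃ r, S.cmul s e = some r) ↔ S.mul s e = some s := by
  rw [S.exists_cmul, he]

theorem mem_range_plus {e : α} : e ∈ Set.range S.plus ↔ S.plus e = e := by
  constructor
  · rintro ⟨x, rfl⟩
    exact S.plus_plus x
  · exact fun h => ⟨e, h⟩

/-- The left constellation of a left restriction semigroupoid, with the natural order. -/
noncomputable def toOrderedData : OrderedData α where
  mul := S.cmul
  plus := S.plus
  c1 x y z := by
    constructor
    · rintro ⟨h1, b, hb⟩
      refine ⟨b, hb, ?_⟩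
      rw [S.exists_cmul] at *
      rwa [S.plus_of_cmul hb]
    · rintro ⟨b, hb, h⟩
      refine ⟨?_, b, hb⟩
      rw [S.exists_cmul] at *
      rwa [S.plus_of_cmul hb] at h
  c2 x y z a b h1 h2 := by
    have hb := S.plus_of_cmul h2
    obtain ⟨h3, h4⟩ := S.cmul_eq.1 h1
    obtain ⟨h5, h6⟩ := S.cmul_eq.1 h2
    obtain ⟨c, hc, hc'⟩ := S.s1 _ _ _ _ _ h4 h6
    obtain ⟨d, hd, hd'⟩ := S.s1 _ _ _ _ _ h4 h5
    rw [h4] at hd'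
    obtain rfl := Option.some.inj hd'
    exact ⟨c, S.cmul_eq.2 ⟨hd, hc⟩, S.cmul_eq.2 ⟨by rw [hb, h3], hc'⟩⟩
  c3 e he x := by
    have he := S.mem_range_plus.1 he
    constructor
    · intro h
      have := S.plus_of_cmul h
      rw [← he, this]
    · rintro rfl
      exact S.cmul_eq.2 ⟨S.plus_mul_plus x, S.lr1 x⟩
  c4 e he x y h := (S.mul_of_proj_cmul (S.mem_range_plus.1 he) h).1
  le := S.NatLE
  le_refl := S.natLE_refl
  le_trans _ _ _ := S.natLE_trans
  le_antisymm _ _ := S.natLE_antisymm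

theorem mem_proj {e : α} : e ∈ S.toOrderedData.proj ↔ S.plus e = e := S.mem_range_plus

/-- Corestrictions are products with projections. -/
theorem isCorestr_iff {x e r : α} (he : S.plus e = e) :
    S.toOrderedData.IsCorestr x e r ↔ S.mul x e = some r := by
  -- If `y ≤ x` and `ye = y`, then `y = (y⁺x)e = y⁺(xe)`, so `xe` is the maximum.
  have key : ∀ r, S.mul x e = some r → S.toOrderedData.IsCorestr x e r := by
    intro r h
    refine ⟨S.mul_proj_natLE he h, ?_, fun y hy hye => ?_⟩
    · refine (S.exists_cmul_proj he).2 ?_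
      obtain ⟨c, hc, hc'⟩ := S.s1 _ _ _ _ _ h (S.proj_mul_proj he)
      rw [hc, ← hc', h]
    · have hye := (S.exists_cmul_proj he).1 hye
      obtain ⟨c, hc, hc'⟩ := S.natLE_mul hy h
      rw [hye] at hc
      obtain rfl := Option.some.inj hc
      exact hc'
  constructor
  · intro h
    have h2 := (S.exists_cmul_proj he).1 h.2.1
    -- Since `r = r⁺x` and `re` is defined, `xe` is defined; uniqueness of the maximum then
    -- identifies it with `r`.
    obtain ⟨b, hb, -⟩ := S.s2 _ _ _ _ _ h.1 h2
    rw [hb, h.unique (key _ hb)]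
  · exact key r

/-- The pseudo-product of the constellation product is the original product. -/
theorem isPseudo_iff {x y r : α} : S.toOrderedData.IsPseudo x y r ↔ S.mul x y = some r := by
  constructor
  · rintro ⟨v, hv, hr⟩
    have hv := (S.isCorestr_iff (S.plus_plus y)).1 hv
    obtain ⟨b, hb, hb'⟩ := S.s2 _ _ _ _ _ hv (S.cmul_eq.1 hr).2
    rw [S.lr1] at hb
    obtain rfl := Option.some.inj hb
    exact hb'
  · intro h
    obtain ⟨v, hv, hv'⟩ := S.s3 _ _ _ _ _ (S.lr1 y) h
    refine ⟨v, (S.isCorestr_iff (S.plus_plus y)).2 hv, S.cmul_eq.2 ⟨?_, hv'⟩⟩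
    obtain ⟨c, hc, hc'⟩ := S.s1 _ _ _ _ _ hv (S.plus_mul_plus y)
    rw [hc, ← hc', hv]

end LRSemigroupoid

/-! ### From left restriction categories to li-constellations -/

namespace LRCategory

variable {α β : Type u} (C : LRCategory α)

local notation "𝐒" => LRCategory.toLRSemigroupoid

/-- Non-emptiness of a corestriction becomes a matter of endpoints, which settles axioms 5 and 6. -/
theorem exists_isCorestr_iff {x e : α} (he : C.plus e = e) :
    (∃ r, (𝐒 C).toOrderedData.IsCorestr x e r) ↔ C.dom x = C.rng e := by
  rw [← C.mul_def]
  exact exists_congr fun r => (𝐒 C).isCorestr_iff he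

theorem dom_proj {e : α} (he : C.plus e = e) : C.dom e = C.rng e := by
  rw [← C.dom_plus e, he]

theorem rng_eq_of_natLE {s t : α} (h : (𝐒 C).NatLE s t) : C.rng s = C.rng t :=
  (C.dom_plus s).symm.trans ((C.mul_def _ _).1 ⟨_, h⟩)

theorem connected_of_natLE {e f : α} (he : C.plus e = e) (hf : C.plus f = f)
    (h : (𝐒 C).NatLE e f) : (𝐒 C).toOrderedData.Connected e f :=
  .rel _ _ ⟨(𝐒 C).mem_proj.2 he, (𝐒 C).mem_proj.2 hf, h⟩

theorem rng_eq_of_connected {e f : α} (h : (𝐒 C).toOrderedData.Connected e f) :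
    C.rng e = C.rng f := by
  induction h with
  | rel _ _ h => exact C.rng_eq_of_natLE h.2.2
  | refl _ => rfl
  | symm _ _ _ ih => exact ih.symm
  | trans _ _ _ _ _ ih1 ih2 => exact ih1.trans ih2

/-- An identity `e` is a right unit for `e⁺`, so `e⁺ = e⁺e = e`. -/
theorem plus_obj {e : α} (he : e ∈ C.objects) : C.plus e = e := by
  have h1 := C.dom_id (C.plus e)
  rw [C.dom_plus, C.rng_obj e he, C.r1] at h1
  exact (Option.some.inj h1).symm

theorem natLE_rng {e : α} (he : C.plus e = e) : (𝐒 C).NatLE e (C.rng e) := by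
  refine ((𝐒 C).natLE_proj_left he).2 ?_
  rw [← C.dom_proj he]
  exact C.dom_id e

theorem connected_rng {e : α} (he : C.plus e = e) :
    (𝐒 C).toOrderedData.Connected e (C.rng e) :=
  C.connected_of_natLE he (C.plus_obj (C.rng_mem e)) (C.natLE_rng he)

/-- A component stays over one object because comparable arrows have equal ranges, and the identity
of that object is above every projection over it. -/
theorem isComponentMax_iff {m : α} :
    (𝐒 C).toOrderedData.IsComponentMax m ↔ m ∈ C.objects := by
  constructor
  · intro h
    have hm := (𝐒 C).mem_proj.1 h.1
    have h1 := h.2 _ ((𝐒 C).mem_proj.2 (C.plus_obj (C.rng_mem m))) (C.connected_rng hm)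
    rw [(𝐒 C).natLE_antisymm (C.natLE_rng hm) h1]
    exact C.rng_mem m
  · intro h
    refine ⟨(𝐒 C).mem_proj.2 (C.plus_obj h), fun f hf hmf => ?_⟩
    have := C.natLE_rng ((𝐒 C).mem_proj.1 hf)
    rwa [← C.rng_eq_of_connected hmf, C.rng_obj m h] at this

/-- The li-constellation of a left restriction category. -/
noncomputable def toLiConstellation : LiConstellation α where
  toOrderedData := (𝐒 C).toOrderedData
  wo1 x x' y y' a b h h' hx hy := by
    have ha := (𝐒 C).plus_of_cmul hx
    obtain ⟨h1, h2⟩ := (𝐒 C).cmul_eq.1 hx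
    obtain ⟨h3, h4⟩ := (𝐒 C).cmul_eq.1 hy
    obtain ⟨c, hc, hc'⟩ := (𝐒 C).natLE_mul h h4
    -- From `xx'⁺ = x` it follows that `xx' = x(x'⁺y') = xy' = x⁺(yy')`, and `x⁺ = (xx')⁺`.
    obtain ⟨d, hd, hd'⟩ := (𝐒 C).s3 _ _ _ _ _ h' h2
    rw [h1] at hd
    obtain rfl := Option.some.inj hd
    rw [hc] at hd'
    obtain rfl := Option.some.inj hd'
    change (𝐒 C).mul ((𝐒 C).plus c) b = some c
    rw [ha, hc']
  wo2 _ _ := (𝐒 C).natLE_plus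
  wo3 e he x h := by
    have he := (𝐒 C).mem_proj.1 he
    have h1 := ((𝐒 C).natLE_proj_left he).1 h
    -- The restriction `e|x` is the product `ex`.
    obtain ⟨r, hr, -⟩ := (𝐒 C).s1 _ _ _ _ _ h1 ((𝐒 C).lr1 x)
    have h2 := (𝐒 C).lr3 e x r (by rw [he]; exact hr)
    rw [he] at h2
    replace h2 := Option.some.inj (h1.symm.trans h2)
    refine ⟨r, ⟨(𝐒 C).proj_mul_natLE he hr, h2.symm⟩, ?_⟩
    rintro s ⟨hs, hse⟩
    have hs : (𝐒 C).mul ((𝐒 C).plus s) x = some s := hs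
    change (𝐒 C).plus s = e at hse
    rw [hse, hr] at hs
    exact (Option.some.inj hs).symm
  wo4 e he x := by
    have he := (𝐒 C).mem_proj.1 he
    rintro ⟨y, hy, hye⟩
    obtain ⟨b, hb, -⟩ := (𝐒 C).s2 _ _ _ _ _ hy (((𝐒 C).exists_cmul_proj he).1 hye)
    exact ⟨b, ((𝐒 C).isCorestr_iff he).2 hb⟩
  wo5 e he x y z h := by
    have he := (𝐒 C).mem_proj.1 he
    rw [C.exists_isCorestr_iff he, C.exists_isCorestr_iff he,
      C.dom_mul _ _ _ ((𝐒 C).cmul_eq.1 h).2]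
  wo6 e he f hf h x := by
    rw [C.exists_isCorestr_iff ((𝐒 C).mem_proj.1 he), C.exists_isCorestr_iff ((𝐒 C).mem_proj.1 hf),
      C.rng_eq_of_natLE h]
  wo7 e he x y z r s t h hr hs ht := by
    have he := (𝐒 C).mem_proj.1 he
    have hr := ((𝐒 C).isCorestr_iff he).1 hr
    have hs := ((𝐒 C).isCorestr_iff he).1 hs
    have ht := ((𝐒 C).isCorestr_iff ((𝐒 C).plus_plus s)).1 ht
    -- Axiom 7 is associativity `(xy)e = x(ye)` followed by `(x(ye))⁺ = (x(ye)⁺)⁺`.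
    obtain ⟨b, hb, hb'⟩ := (𝐒 C).s2 _ _ _ _ _ ((𝐒 C).cmul_eq.1 h).2 hr
    rw [hs] at hb
    obtain rfl := Option.some.inj hb
    exact ((𝐒 C).plus_mul_plus_eq hb' ht).symm
  wo8 e he f hf h := by
    have he := (𝐒 C).mem_proj.1 he
    exact ⟨e, ⟨h, he⟩, ((𝐒 C).isCorestr_iff ((𝐒 C).mem_proj.1 hf)).2
      (((𝐒 C).natLE_proj_left he).1 h)⟩
  wo9 e he f hf h := by
    have he := (𝐒 C).mem_proj.1 he
    have hf := (𝐒 C).mem_proj.1 hf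
    obtain ⟨z, hz⟩ := (C.mul_def e f).2 ((C.dom_proj he).trans (C.rng_eq_of_connected h))
    refine ⟨z, ⟨(𝐒 C).mem_proj.2 ((𝐒 C).plus_proj_mul_proj he hf hz), (𝐒 C).mul_proj_natLE hf hz,
      (𝐒 C).proj_mul_natLE he hz, fun w hw h1 h2 => ?_⟩, ((𝐒 C).isCorestr_iff hf).2 hz⟩
    have hw := (𝐒 C).mem_proj.1 hw
    obtain ⟨c, hc, hc'⟩ := (𝐒 C).natLE_mul h1 hz
    rw [((𝐒 C).natLE_proj_left hw).1 h2] at hc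
    obtain rfl := Option.some.inj hc
    exact hc'
  wo9_dom e he f hf r h := by
    have he := (𝐒 C).mem_proj.1 he
    have hf := (𝐒 C).mem_proj.1 hf
    have h := ((𝐒 C).isCorestr_iff hf).1 h
    have hr := (𝐒 C).plus_proj_mul_proj he hf h
    -- The projection `ef` lies below both `e` and `f`, and so links them.
    exact .trans _ r _ (.symm _ _ (C.connected_of_natLE hr he ((𝐒 C).mul_proj_natLE hf h)))
      (C.connected_of_natLE hr hf ((𝐒 C).proj_mul_natLE he h))

theorem toLiConstellation_nonDegenerate : C.toLiConstellation.NonDegenerate := fun x =>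
  ⟨C.dom x, (𝐒 C).mem_proj.2 (C.plus_obj (C.dom_mem x)), x,
    ((𝐒 C).isCorestr_iff (C.plus_obj (C.dom_mem x))).2 (C.dom_id x)⟩

theorem toLiConstellation_unitary : C.toLiConstellation.Unitary := by
  refine ⟨fun e he => ⟨C.rng e, C.connected_rng ((𝐒 C).mem_proj.1 he),
    C.isComponentMax_iff.2 (C.rng_mem e)⟩, fun m hm x r h => ?_⟩
  have hm' := C.isComponentMax_iff.1 hm
  have h : C.mul x m = some r := ((𝐒 C).isCorestr_iff (C.plus_obj hm')).1 h
  have h1 := (C.mul_def x m).1 ⟨r, h⟩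
  rw [C.rng_obj m hm'] at h1
  rw [← h1, C.dom_id] at h
  exact (Option.some.inj h).symm

/-! ### Comparison of morphisms -/

/-- A radiant preserves corestrictions and constellation products, hence pseudo-products.
Conversely, the constellation product, the order and the corestrictions are all defined by equations
in the product and `plus`. -/
theorem isRadiant_iff (C : LRCategory α) (D : LRCategory β) (φ : α → β) :
    C.toLiConstellation.IsRadiant D.toLiConstellation φ ↔
      LRSemigroupoid.IsRestrictionMorphism (𝐒 C) (𝐒 D) φ := by
  constructor
  · intro h
    refine ⟨fun s t r hr => ?_, fun s => (h.ir2 s).symm⟩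
    obtain ⟨v, hv, hr⟩ := (𝐒 C).isPseudo_iff.2 hr
    refine (𝐒 D).isPseudo_iff.1 ⟨φ v, ?_, h.ir1 _ _ _ hr⟩
    have := h.ir4 s _ (C.toLiConstellation.plus_mem t) v hv
    rwa [← h.ir2] at this
  · intro h
    refine ⟨fun x y z hz => ?_, fun x => (h.rm2 x).symm, fun x y hxy => ?_, fun x e he r hr => ?_⟩
    · obtain ⟨h1, h2⟩ := (𝐒 C).cmul_eq.1 hz
      refine (𝐒 D).cmul_eq.2 ⟨?_, h.rm1 _ _ _ h2⟩
      rw [← h.rm2]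
      exact h.rm1 _ _ _ h1
    · have := h.rm1 _ _ _ hxy
      rwa [h.rm2] at this
    · have he := (𝐒 C).mem_proj.1 he
      refine ((𝐒 D).isCorestr_iff ?_).2 (h.rm1 _ _ _ (((𝐒 C).isCorestr_iff he).1 hr))
      rw [← h.rm2, he]

theorem toLRSemigroupoid_toLiConstellation : C.toLiConstellation.toLRSemigroupoid = 𝐒 C := by
  apply LRSemigroupoid.ext
  · funext x y
    ext r
    exact C.toLiConstellation.mul_eq.trans (𝐒 C).isPseudo_iff
  · rfl

theorem isPreradiant_iff (C : LRCategory α) (D : LRCategory β) (φ : α → β) :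
    C.toLiConstellation.IsPreradiant D.toLiConstellation φ ↔
      LRSemigroupoid.IsPremorphism (𝐒 C) (𝐒 D) φ := by
  constructor
  · intro h
    have := h.isPremorphism
    rwa [toLRSemigroupoid_toLiConstellation, toLRSemigroupoid_toLiConstellation] at this
  · intro h
    have map_proj : ∀ e, (𝐒 C).plus e = e → (𝐒 D).plus (φ e) = φ e := fun e he => by
      rw [← he]
      exact h.plus_image e
    refine ⟨fun x y z hz => ?_, h.pm2, fun x y => h.mono, fun x e he r hr => ?_,
      fun x e he hex r hr => ?_⟩
    · obtain ⟨q, h1, h2⟩ := h.pm1 _ _ _ ((𝐒 C).cmul_eq.1 hz).2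
      exact ⟨q, (𝐒 D).isPseudo_iff.2 h1, (𝐒 D).isPseudo_iff.2 h2⟩
    · have he := (𝐒 C).mem_proj.1 he
      refine ((𝐒 D).isCorestr_iff (map_proj e he)).2 ?_
      have hr := ((𝐒 C).isCorestr_iff he).1 hr
      obtain ⟨q, h1, h2⟩ := h.pm1 _ _ _ hr
      -- From `xe ≤ x`, `φ(xe)⁺ ≤ φ(x)⁺`, so the factor `φ(x)⁺` in (pm1) acts trivially on `φ(xe)`.
      rw [(𝐒 D).proj_mul_of_natLE ((𝐒 D).natLE_plus (h.mono ((𝐒 C).mul_proj_natLE he hr)))] at h2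
      rw [h1, h2]
    · have he := (𝐒 C).mem_proj.1 he
      have hex : (𝐒 C).mul e x = some r := hr.2 ▸ hr.1
      have hre : (𝐒 C).plus r = e := hr.2
      obtain ⟨q, h1, h2⟩ := h.pm1 _ _ _ hex
      -- Now `φ(r)⁺ ≤ φ(r⁺) = φ(e)`, so (pm1) reduces to `φ(e)φ(x) = φ(r)`; applying `plus` gives
      -- `φ(e)φ(x)⁺ = φ(r)⁺`.
      have h3 := h.pm2 r
      rw [hre, ← map_proj e he] at h3
      rw [(𝐒 D).proj_mul_of_natLE h3] at h2
      obtain rfl := Option.some.inj h2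
      have h4 := (𝐒 D).lr3 (φ e) (φ x) _ (by rw [map_proj e he]; exact h1)
      rw [map_proj e he] at h4
      exact ((𝐒 D).isCorestr_iff ((𝐒 D).plus_plus _)).2 h4

end LRCategory

/-! ### From li-constellations to left restriction categories -/

namespace LiConstellation

variable {α : Type u} (T : LiConstellation α)

local notation "𝐓" => LiConstellation.toLRSemigroupoid

-- Projections multiply only within one component, where each of the two maxima dominates the other.
variable {T} in
theorem componentMax_eq_of_mul {m m' r : α} (h : T.IsComponentMax m) (h' : T.IsComponentMax m')
    (hr : (𝐓 T).mul m m' = some r) : m = m' := by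
  have hc := T.wo9_dom _ h.1 _ h'.1 _ ((T.pseudo_proj h'.1).1 (T.mul_eq.1 hr))
  exact T.le_antisymm _ _ (h'.2 _ h.1 (hc.symm _ _)) (h.2 _ h'.1 hc)

variable {T} in
theorem eq_of_mul_componentMax (hu : T.Unitary) {m x r : α} (h : T.IsComponentMax m)
    (hr : (𝐓 T).mul x m = some r) : r = x :=
  hu.2 m h x r ((T.pseudo_proj h.1).1 (T.mul_eq.1 hr))

-- Unitarity gives `xm = x`, so `xm' = (xm)m'` forces `mm'` to be defined.
variable {T} in
theorem componentMax_unique (hu : T.Unitary) {m m' x r r' : α} (h : T.IsComponentMax m)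
    (h' : T.IsComponentMax m') (hr : (𝐓 T).mul x m = some r) (hr' : (𝐓 T).mul x m' = some r') :
    m = m' := by
  obtain rfl := eq_of_mul_componentMax hu h hr
  obtain ⟨b, hb, -⟩ := (𝐓 T).s2 _ _ _ _ _ hr hr'
  exact componentMax_eq_of_mul h h' hb

/-- Non-degeneracy supplies some `e` with `x|e ≠ ∅`, axiom 6 moves it up to the maximum of its
component, and unitarity makes that corestriction equal to `x`. -/
theorem exists_componentMax (hn : T.NonDegenerate) (hu : T.Unitary) (x : α) :
    ∃ m, T.IsComponentMax m ∧ (𝐓 T).mul x m = some x := by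
  obtain ⟨e, he, hx⟩ := hn x
  obtain ⟨m, hem, hm⟩ := hu.1 e he
  obtain ⟨r, hr⟩ := (T.wo6 m hm.1 e he (hm.2 e he (hem.symm _ _)) x).2 hx
  have hr := T.mul_eq.2 ((T.pseudo_proj hm.1).2 hr)
  obtain rfl := eq_of_mul_componentMax hu hm hr
  exact ⟨m, hm, hr⟩

/-- The maximum `m` of a component of `(T⁺, ≤)` such that `x|m = x`. -/
noncomputable def dom (hn : T.NonDegenerate) (hu : T.Unitary) (x : α) : α :=
  (T.exists_componentMax hn hu x).choose

variable {T} (hn : T.NonDegenerate) (hu : T.Unitary)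

theorem isComponentMax_dom (x : α) : T.IsComponentMax (T.dom hn hu x) :=
  (T.exists_componentMax hn hu x).choose_spec.1

theorem mul_dom (x : α) : (𝐓 T).mul x (T.dom hn hu x) = some x :=
  (T.exists_componentMax hn hu x).choose_spec.2

/-- This reduces every statement about domains and ranges to the definedness of one product. -/
theorem dom_eq_of_mul {x m r : α} (h : T.IsComponentMax m) (hr : (𝐓 T).mul x m = some r) :
    T.dom hn hu x = m :=
  componentMax_unique hu (isComponentMax_dom hn hu x) h (mul_dom hn hu x) hr

/-- Projections commute, so the right unit of `x⁺` is also a left unit of `x⁺`, hence of `x = x⁺x`.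
This justifies taking it as the range. -/
theorem dom_plus_mul (x : α) : (𝐓 T).mul (T.dom hn hu (T.plus x)) x = some x := by
  have hm := isComponentMax_dom hn hu (T.plus x)
  have h1 := mul_dom hn hu (T.plus x)
  have h2 : (𝐓 T).plus (T.dom hn hu (T.plus x)) = _ := T.proj_plus hm.1
  rw [(𝐓 T).proj_mul_comm (T.plus_plus x) h2] at h1
  obtain ⟨c, hc, hc'⟩ := (𝐓 T).s1 _ _ _ _ _ h1 ((𝐓 T).lr1 x)
  have h3 : (𝐓 T).mul (T.plus x) x = some x := (𝐓 T).lr1 x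
  rw [h3] at hc
  rw [hc', hc]

theorem dom_of_mem {e : α} (h : T.IsComponentMax e) : T.dom hn hu e = e :=
  dom_eq_of_mul hn hu h ((𝐓 T).proj_mul_proj (T.proj_plus h.1))

/-- The left restriction category of a non-degenerate unitary li-constellation. -/
noncomputable def toLRCategory (hn : T.NonDegenerate) (hu : T.Unitary) : LRCategory α where
  mul := T.pmul
  objects := {m | T.IsComponentMax m}
  dom := T.dom hn hu
  rng x := T.dom hn hu (T.plus x)
  dom_mem := isComponentMax_dom hn hu
  rng_mem x := isComponentMax_dom hn hu (T.plus x)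
  dom_obj _ := dom_of_mem hn hu
  rng_obj e he := by
    rw [T.proj_plus he.1, dom_of_mem hn hu he]
  mul_def f g := by
    constructor
    · rintro ⟨h, hh⟩
      -- Writing `g` as its range times `g` shows that `f` composes with the range of `g`, which
      -- must then be the domain of `f`.
      obtain ⟨a, ha, -⟩ := (𝐓 T).s3 _ _ _ _ _ (dom_plus_mul hn hu g) hh
      exact dom_eq_of_mul hn hu (isComponentMax_dom hn hu _) ha
    · intro h
      have h1 := mul_dom hn hu f
      rw [h] at h1
      obtain ⟨c, hc, -⟩ := (𝐓 T).s1 _ _ _ _ _ h1 (dom_plus_mul hn hu g)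
      exact ⟨c, hc⟩
  dom_mul f g h hh := by
    obtain ⟨c, hc, -⟩ := (𝐓 T).s1 _ _ _ _ _ hh (mul_dom hn hu g)
    exact dom_eq_of_mul hn hu (isComponentMax_dom hn hu _) hc
  rng_mul f g h hh := by
    -- As `(fg)⁺ ≤ f⁺`, the projection `(fg)⁺` composes with the range of `f`.
    have h1 := (𝐓 T).plus_le_of_mul hh
    obtain ⟨c, hc, -⟩ := (𝐓 T).natLE_mul h1 (mul_dom hn hu (T.plus f))
    exact dom_eq_of_mul hn hu (isComponentMax_dom hn hu _) hc
  rng_id := dom_plus_mul hn hu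
  dom_id := mul_dom hn hu
  assoc f g h a b h1 h2 := by
    obtain ⟨c, hc, hc'⟩ := (𝐓 T).s1 _ _ _ _ _ h1 h2
    exact hc.trans hc'.symm
  plus := T.plus
  dom_plus _ := rfl
  rng_plus f := by rw [T.plus_plus]
  r1 := (𝐓 T).lr1
  r2 f g _ := (𝐓 T).lr2 f g
  r3 f g h _ := (𝐓 T).lr3 f g h
  r4 f g h _ hh := by
    obtain ⟨q, h1, h2⟩ := (𝐓 T).lr4 _ _ _ hh
    exact h1.trans h2.symm

/-- The condition `x ⊗ y⁺ = x` says `x|y⁺ = x`, and then `x ⊗ y` is the constellation product `xy`.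
-/
theorem toLiConstellation_toLRCategory : (toLRCategory hn hu).toLiConstellation = T := by
  apply LiConstellation.ext
  · funext x y
    ext r
    refine (LRSemigroupoid.cmul_eq _).trans ((and_congr T.mul_eq T.mul_eq).trans ?_)
    constructor
    · rintro ⟨h1, v, hv, hr⟩
      obtain rfl := ((T.pseudo_proj (T.plus_mem y)).1 h1).unique hv
      exact hr
    · exact fun h => ⟨(T.pseudo_proj (T.plus_mem y)).2
          (OrderedData.isCorestr_of_dfd ((T.dfd_plus x y).2 ⟨r, h⟩)),
        OrderedData.isPseudo_of_mul h⟩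
  · rfl
  · funext x y
    exact propext T.natLE_iff

end LiConstellation

/-! ### The strict isomorphisms of categories -/

theorem LRCategory.toLRCategory_toLiConstellation {α : Type u} (C : LRCategory α) :
    LiConstellation.toLRCategory C.toLiConstellation_nonDegenerate C.toLiConstellation_unitary =
      C := by
  have hmul : C.toLiConstellation.toLRSemigroupoid.mul = C.mul := by
    rw [C.toLRSemigroupoid_toLiConstellation]
    rfl
  have hdom : ∀ x, LiConstellation.dom _ C.toLiConstellation_nonDegenerate
      C.toLiConstellation_unitary x = C.dom x := fun x =>
    LiConstellation.dom_eq_of_mul _ _ (C.isComponentMax_iff.2 (C.dom_mem x))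
      ((congrFun (congrFun hmul _) _).trans (C.dom_id x))
  apply LRCategory.ext
  · exact hmul
  · exact Set.ext fun m => C.isComponentMax_iff
  · exact funext hdom
  · exact funext fun x => (hdom (C.plus x)).trans (C.dom_plus x)
  · rfl

theorem isRadiant_iff_toLRCategory {α β : Type u} {T : LiConstellation α} {L : LiConstellation β}
    (hn : T.NonDegenerate) (hu : T.Unitary) (hn' : L.NonDegenerate) (hu' : L.Unitary)
    (φ : α → β) : T.IsRadiant L φ ↔ LRSemigroupoid.IsRestrictionMorphism
      (LiConstellation.toLRCategory hn hu).toLRSemigroupoid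
      (LiConstellation.toLRCategory hn' hu').toLRSemigroupoid φ := by
  rw [← LRCategory.isRadiant_iff, LiConstellation.toLiConstellation_toLRCategory,
    LiConstellation.toLiConstellation_toLRCategory]

theorem isPreradiant_iff_toLRCategory {α β : Type u} {T : LiConstellation α}
    {L : LiConstellation β} (hn : T.NonDegenerate) (hu : T.Unitary) (hn' : L.NonDegenerate)
    (hu' : L.Unitary) (φ : α → β) : T.IsPreradiant L φ ↔ LRSemigroupoid.IsPremorphism
      (LiConstellation.toLRCategory hn hu).toLRSemigroupoid
      (LiConstellation.toLRCategory hn' hu').toLRSemigroupoid φ := by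
  rw [← LRCategory.isPreradiant_iff, LiConstellation.toLiConstellation_toLRCategory,
    LiConstellation.toLiConstellation_toLRCategory]

theorem isomorphicCategories_restr : IsomorphicCategories LRCatRestr.{u} NDULiConstRad.{u} := by
  let F : LRCatRestr.{u} ⥤ NDULiConstRad.{u} :=
    { obj := fun C => ⟨C.carrier, C.str.toLiConstellation, C.str.toLiConstellation_nonDegenerate,
        C.str.toLiConstellation_unitary⟩
      map := fun {C D} φ => ⟨φ.1, (LRCategory.isRadiant_iff C.str D.str φ.1).2 φ.2⟩ }
  let G : NDULiConstRad.{u} ⥤ LRCatRestr.{u} :=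
    { obj := fun T => ⟨T.carrier, LiConstellation.toLRCategory T.nonDegenerate T.unitary⟩
      map := fun {T L} φ => ⟨φ.1, (isRadiant_iff_toLRCategory _ _ _ _ φ.1).1 φ.2⟩ }
  have hFG : ∀ C, G.obj (F.obj C) = C := fun ⟨c, C⟩ =>
    congrArg (LRCatRestr.mk c) C.toLRCategory_toLiConstellation
  have hGF : ∀ T, F.obj (G.obj T) = T := fun ⟨c, T, hn, hu⟩ => by
    simp only [F, G, LiConstellation.toLiConstellation_toLRCategory]
  -- Hom-sets are subtypes of function types and both functors fix the underlying function, so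
  -- heterogeneous equality only needs the two predicates to agree, which the round trips on
  -- structures give.
  refine ⟨F, G, Functor.hext hFG fun C D φ => ?_, Functor.hext hGF fun T L φ => ?_⟩
  · refine (Subtype.heq_iff_coe_eq fun ψ => ?_).2 rfl
    simp only [F, G, Functor.comp_obj, Functor.id_obj, LRCategory.toLRCategory_toLiConstellation]
  · refine (Subtype.heq_iff_coe_eq fun ψ => ?_).2 rfl
    simp only [F, G, Functor.comp_obj, Functor.id_obj,
      LiConstellation.toLiConstellation_toLRCategory]

theorem isomorphicCategories_pre : IsomorphicCategories LRCatPre.{u} NDULiConstPrerad.{u} := by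
  let F : LRCatPre.{u} ⥤ NDULiConstPrerad.{u} :=
    { obj := fun C => ⟨C.carrier, C.str.toLiConstellation, C.str.toLiConstellation_nonDegenerate,
        C.str.toLiConstellation_unitary⟩
      map := fun {C D} φ => ⟨φ.1, (LRCategory.isPreradiant_iff C.str D.str φ.1).2 φ.2⟩ }
  let G : NDULiConstPrerad.{u} ⥤ LRCatPre.{u} :=
    { obj := fun T => ⟨T.carrier, LiConstellation.toLRCategory T.nonDegenerate T.unitary⟩
      map := fun {T L} φ => ⟨φ.1, (isPreradiant_iff_toLRCategory _ _ _ _ φ.1).1 φ.2⟩ }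
  have hFG : ∀ C, G.obj (F.obj C) = C := fun ⟨c, C⟩ =>
    congrArg (LRCatPre.mk c) C.toLRCategory_toLiConstellation
  have hGF : ∀ T, F.obj (G.obj T) = T := fun ⟨c, T, hn, hu⟩ => by
    simp only [F, G, LiConstellation.toLiConstellation_toLRCategory]
  refine ⟨F, G, Functor.hext hFG fun C D φ => ?_, Functor.hext hGF fun T L φ => ?_⟩
  · refine (Subtype.heq_iff_coe_eq fun ψ => ?_).2 rfl
    simp only [F, G, Functor.comp_obj, Functor.id_obj, LRCategory.toLRCategory_toLiConstellation]
  · refine (Subtype.heq_iff_coe_eq fun ψ => ?_).2 rfl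
    simp only [F, G, Functor.comp_obj, Functor.id_obj,
      LiConstellation.toLiConstellation_toLRCategory]

end ESN

theorem mainTheorem5 :
    ESN.IsomorphicCategories ESN.LRCatRestr.{u} ESN.NDULiConstRad.{u} ∧
    ESN.IsomorphicCategories ESN.LRCatPre.{u} ESN.NDULiConstPrerad.{u} :=
  ⟨ESN.isomorphicCategories_restr, ESN.isomorphicCategories_pre⟩
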